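/- Identify $\mathbb{R}^2$ with $\mathbb{C}$ via $x=x_1+ix_2$, let $x\cdot y=\operatorname{Re}(\bar x y)$, and let $J=\begin{pmatrix}0&1\\-1&0\end{pmatrix}$, $a^0(x)=-\frac12 Jx$, $\Delta_{a^0}=(\nabla-ia^0)\cdot(\nabla-ia^0)$. For $\operatorname{Im}\tau>0$ let $$\mathcal{L}_\tau=\sqrt{\tfrac{2\pi}{\operatorname{Im}\tau}}\,(\mathbb{Z}+\tau\mathbb{Z}),\qquad \mathcal{L}_\tau^*=\{t\in\mathbb{C}: t\cdot s\in 2\pi\mathbb{Z}\ \text{ for all } s\in\mathcal{L}_\tau\},$$ and let $\langle f\rangle=\frac1{|\Omega_\tau|}\int_{\Omega_\tau}f$ be the mean value over a fundamental cell $\Omega_\tau$ of $\mathcal{L}_\tau$. **Theorem.** Let $\operatorname{Im}\tau>0$. For every $k\in\mathbb{C}$ (in particular for $k$ in a fundamental cell of $\mathcal{L}^*_\tau$) there is a $C^2$ function $\phi_k:\mathbb{R}^2\to\mathbb{C}$, unique up to multiplication by a constant of modulus one, such that $$(-\Delta_{a^0}-1)\phi_k=0,\qquad \langle|\phi_k|^2\rangle=1,$$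 $$\phi_k(x+s)=(-1)^{mn}e^{\frac i2 s\cdot Jx}\,e^{ik\cdot s}\,\phi_k(x)\quad\text{for all } x \text{ and all } s=\sqrt{\tfrac{2\pi}{\operatorname{Im}\tau}}\,(m+n\tau),\ m,n\in\mathbb{Z}.$$ For any choice of these functions, the quantity $$\gamma_k(\tau)=2\langle|\phi_0|^2|\phi_k|^2\rangle+\bigl|\langle\phi_0^2\,\bar\phi_k\,\bar\phi_{-k}\rangle\bigr|-\langle|\phi_0|^4\rangle$$ satisfies, for every $k\in\mathbb{C}$, $$\gamma_k(\tau)=2\sum_{t\in\mathcal{L}_\tau^*}e^{-\frac12|t|^2}\cos[\operatorname{Im}(\bar kt)]+\Bigl|\sum_{t\in\mathcal{L}_\tau^*}e^{-\frac12|t+k|^2+i\operatorname{Im}(\bar kt)}\Bigr|-\sum_{t\in\mathcal{L}_\tau^*}e^{-\frac12|t|^2},$$ where all the series converge absolutely. -/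

import Mathlib

open MeasureTheory
open scoped ComplexConjugate

noncomputable section

namespace Abrikosov

/-! The plane `ℝ²` is identified with `ℂ` through `x = x₁ + i x₂`; the Euclidean dot product
`x · y` is then `inner ℝ x y`, and `volume` on `ℂ` is planar Lebesgue measure. -/

/-- The matrix `J = ((0, 1), (-1, 0))` acting on the plane: `J x = (x₂, -x₁)`. -/
def J (x : ℂ) : ℂ := ⟨x.im, -x.re⟩

/-- The vector potential `a⁰(x) = -(1/2) J x` of the constant magnetic field `1`. -/
def a0 (x : ℂ) : ℂ := -(1 / 2 : ℝ) • J x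

/-- The covariant derivative `(v · (∇ - iA)) φ` in the direction `v`. -/
def covDeriv (A : ℂ → ℂ) (v : ℂ) (φ : ℂ → ℂ) (x : ℂ) : ℂ :=
  fderiv ℝ φ x v - Complex.I * ((inner ℝ (A x) v : ℝ) : ℂ) * φ x

/-- The covariant Laplacian `Δ_A = (∇ - iA) · (∇ - iA)`; the coordinate directions are
`1` and `i`. -/
def covLaplacian (A : ℂ → ℂ) (φ : ℂ → ℂ) (x : ℂ) : ℂ :=
  covDeriv A 1 (covDeriv A 1 φ) x + covDeriv A Complex.I (covDeriv A Complex.I φ) x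

/-- The point `√(2π / Im τ) (u + v τ)` with real coordinates `u, v`. -/
def point (τ : ℂ) (u v : ℝ) : ℂ :=
  (Real.sqrt (2 * Real.pi / τ.im) : ℂ) * ((u : ℂ) + (v : ℂ) * τ)

/-- The lattice `L_τ = √(2π / Im τ) (ℤ + τ ℤ)`. -/
def lattice (τ : ℂ) : Set ℂ := {s | ∃ m n : ℤ, s = point τ m n}

/-- The dual lattice `L*_τ`: all `t` with `t · s ∈ 2πℤ` for every `s ∈ L_τ`. -/
def dualLattice (τ : ℂ) : Set ℂ :=
  {t | ∀ s ∈ lattice τ, ∃ n : ℤ, (inner ℝ t s : ℝ) = 2 * Real.pi * (n : ℝ)}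

/-- The fundamental cell `Ω_τ` of `L_τ` spanned by the two generators. -/
def cell (τ : ℂ) : Set ℂ :=
  {x | ∃ u ∈ Set.Ico (0 : ℝ) 1, ∃ v ∈ Set.Ico (0 : ℝ) 1, x = point τ u v}

/-- `φ` is a normalized solution with quasimomentum `k`: a classical solution of
`(-Δ_{a⁰} - 1) φ = 0` with `φ (x + s) = (-1)^{mn} e^{(i/2) s · J x} e^{i k · s} φ x` for
all `s = √(2π / Im τ) (m + n τ)` in `L_τ`, and with mean value of `|φ|²` over a cell equal to `1`.
The sign `(-1)^{mn}` makes the multipliers a cocycle. It is `1` on both generators. -/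
structure IsNormalizedSolution (τ k : ℂ) (φ : ℂ → ℂ) : Prop where
  contDiff : ContDiff ℝ 2 φ
  eigen : ∀ x, -covLaplacian a0 φ x - φ x = 0
  quasiPeriodic : ∀ m n : ℤ, ∀ x : ℂ,
    φ (x + point τ m n) =
      (-1 : ℂ) ^ (m * n)
        * Complex.exp (Complex.I * (((1 / 2) * inner ℝ (point τ m n) (J x) : ℝ) : ℂ))
        * Complex.exp (Complex.I * ((inner ℝ k (point τ m n) : ℝ) : ℂ)) * φ x
  normalized : (⨍ x in cell τ, ‖φ x‖ ^ 2) = 1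

/-- `γ_k(τ) = 2⟨|φ₀|²|φ_k|²⟩ + |⟨φ₀² φ̄_k φ̄_{-k}⟩| - ⟨|φ₀|⁴⟩`, where `⟨·⟩` is the mean value over a
fundamental cell, for a family `φ` of functions indexed by the quasimomentum. -/
def gammaK (τ : ℂ) (φ : ℂ → ℂ → ℂ) (k : ℂ) : ℝ :=
  2 * (⨍ x in cell τ, ‖φ 0 x‖ ^ 2 * ‖φ k x‖ ^ 2)
    + ‖⨍ x in cell τ, φ 0 x ^ 2 * conj (φ k x) * conj (φ (-k) x)‖
    - ⨍ x in cell τ, ‖φ 0 x‖ ^ 4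

end Abrikosov

end

namespace Abrikosov

/-! Write D₁, D₂ for the covariant derivatives along the axes. Since [D₁, D₂] = -i, one has Δ + 1 =
(D₁ - iD₂)(D₁ + iD₂), with D₁ + iD₂ = 2∂̄ + x/2. For a solution φ, the function ψ = (D₁ + iD₂)φ has
lattice-periodic modulus, hence is bounded, and (D₁ - iD₂)ψ = 0 makes conj(e^{-|x|²/4}ψ) entire and
vanishing at infinity, so ψ = 0 by Liouville. Thus e^{|x|²/4}φ is entire, and an explicit
exponential factor turns it into a function obeying the translation law of a shifted Jacobi theta
function. That law ties all Fourier coefficients to the zeroth one, so solutions form at most a line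
(`IsNormalizedSolution.unique`); `jacobiTheta₂` itself yields the solution `landau`.

For the averages, the product of two theta functions in e^{ik·x} φ₀ φ̄_k is resummed, by a change of
indices and Jacobi's functional equation, into a Fourier series over the dual lattice with Gaussian
coefficients (`hasSum_landau_zero_mul_conj`). Because |φ_k(x)| = |φ₀(x + ik)|, the case k = 0 also
expands every |φ_k|². Parseval (`hasSum_average_mul`) evaluates the means, and `gammaK_eq` shows
that the choice of phases is immaterial. -/

theorem inner_a0 (x v : ℂ) : inner ℝ (a0 x) v = (x.re * v.im - x.im * v.re) / 2 := by
  simp [a0, J, Complex.inner]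
  ring

/-! ### Factorization of the covariant Laplacian and holomorphy -/

/-- The covariant derivative `2∂̄ + x/2`, which annihilates the lowest Landau level. -/
noncomputable def annih (φ : ℂ → ℂ) (x : ℂ) : ℂ :=
  covDeriv a0 1 φ x + Complex.I * covDeriv a0 Complex.I φ x

theorem covDeriv_a0 (v : ℂ) (φ : ℂ → ℂ) (x : ℂ) :
    covDeriv a0 v φ x
      = fderiv ℝ φ x v - Complex.I * (((x.re : ℂ) * v.im - x.im * v.re) / 2) * φ x := by
  rw [covDeriv, inner_a0]
  push_cast
  rfl

theorem hasFDerivAt_covDeriv {φ : ℂ → ℂ} (hφ : ContDiff ℝ 2 φ) (v x : ℂ) :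
    HasFDerivAt (covDeriv a0 v φ)
      ((ContinuousLinearMap.apply ℝ ℂ v).comp (fderiv ℝ (fderiv ℝ φ) x)
        - Complex.I • ((((x.re : ℂ) * v.im - x.im * v.re) / 2) • fderiv ℝ φ x
          + φ x • (((2⁻¹ : ℂ) * v.im) • (Complex.ofRealCLM.comp Complex.reCLM)
            - ((2⁻¹ : ℂ) * v.re) • (Complex.ofRealCLM.comp Complex.imCLM)))) x := by
  have h1 : HasFDerivAt (fderiv ℝ φ) (fderiv ℝ (fderiv ℝ φ) x) x :=
    ((hφ.fderiv_right (m := 1) (by norm_num)).differentiable (by norm_num) x).hasFDerivAt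
  have h2 : HasFDerivAt φ (fderiv ℝ φ x) x := (hφ.differentiable (by norm_num) x).hasFDerivAt
  have h3 : HasFDerivAt (fun y : ℂ => ((y.re : ℂ) * v.im - y.im * v.re) / 2)
      (((2⁻¹ : ℂ) * v.im) • (Complex.ofRealCLM.comp Complex.reCLM)
            - ((2⁻¹ : ℂ) * v.re) • (Complex.ofRealCLM.comp Complex.imCLM)) x := by
    have := (((2⁻¹ : ℂ) * v.im) • (Complex.ofRealCLM.comp Complex.reCLM)
            - ((2⁻¹ : ℂ) * v.re) • (Complex.ofRealCLM.comp Complex.imCLM)).hasFDerivAt (x := x)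
    refine this.congr_of_eventuallyEq (Filter.Eventually.of_forall fun y => ?_)
    simp
    ring
  have h4 := ((ContinuousLinearMap.apply ℝ ℂ v).hasFDerivAt.comp x h1).sub
    ((h3.mul h2).const_mul Complex.I)
  refine h4.congr_of_eventuallyEq (Filter.Eventually.of_forall fun y => ?_)
  simp [covDeriv_a0]
  ring

/-- The zeroth-order term is i[D₁, D₂] = 1, the commutator being -i times the unit magnetic field.
-/
theorem covLaplacian_a0_add_self {φ : ℂ → ℂ} (hφ : ContDiff ℝ 2 φ) (x : ℂ) :
    covLaplacian a0 φ x + φ x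
      = covDeriv a0 1 (annih φ) x - Complex.I * covDeriv a0 Complex.I (annih φ) x := by
  have hsym : fderiv ℝ (fderiv ℝ φ) x 1 Complex.I = fderiv ℝ (fderiv ℝ φ) x Complex.I 1 :=
    (hφ.contDiffAt.isSymmSndFDerivAt (by simp)) 1 Complex.I
  have h1 := hasFDerivAt_covDeriv hφ 1 x
  have h2 := hasFDerivAt_covDeriv hφ Complex.I x
  have h3 : HasFDerivAt (annih φ) _ x := h1.add (h2.const_mul Complex.I)
  simp only [covLaplacian, covDeriv_a0 _ (annih φ), covDeriv_a0 _ (covDeriv _ _ _), h1.fderiv,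
    h2.fderiv, h3.fderiv, annih, covDeriv_a0 _ φ]
  simp [hsym]
  linear_combination (φ x + Complex.I ^ 2 * φ x * x.re ^ 2 / 4
    + fderiv ℝ (fderiv ℝ φ) x Complex.I Complex.I - Complex.I * x.re * fderiv ℝ φ x Complex.I)
    * Complex.I_sq

theorem differentiable_annih {φ : ℂ → ℂ} (hφ : ContDiff ℝ 2 φ) : Differentiable ℝ (annih φ) :=
  fun x =>
  ((hasFDerivAt_covDeriv hφ 1 x).add
    ((hasFDerivAt_covDeriv hφ Complex.I x).const_mul Complex.I)).differentiableAt

theorem fderiv_exp_mul {ψ : ℂ → ℂ} (hψ : Differentiable ℝ ψ) (c : ℝ) (x v : ℂ) :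
    fderiv ℝ (fun y => (Real.exp (c * ‖y‖ ^ 2) : ℂ) * ψ y) x v
      = Real.exp (c * ‖x‖ ^ 2) * (fderiv ℝ ψ x v
        + c * (2 * ((x.re : ℂ) * v.re + x.im * v.im)) * ψ x) := by
  have h1 : HasFDerivAt (fun y : ℂ => Real.exp (c * ‖y‖ ^ 2)) _ x :=
    (((hasStrictFDerivAt_norm_sq x).hasFDerivAt).const_mul c).exp
  have h2 : HasFDerivAt (fun y : ℂ => (Real.exp (c * ‖y‖ ^ 2) : ℂ)) _ x :=
    Complex.ofRealCLM.hasFDerivAt.comp x h1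
  have h3 : HasFDerivAt (fun y => (Real.exp (c * ‖y‖ ^ 2) : ℂ) * ψ y) _ x :=
    h2.mul (hψ x).hasFDerivAt
  rw [h3.fderiv]
  simp [Complex.inner]
  ring

theorem differentiable_exp_mul {ψ : ℂ → ℂ} (hψ : Differentiable ℝ ψ) (c : ℝ) :
    Differentiable ℝ (fun y => (Real.exp (c * ‖y‖ ^ 2) : ℂ) * ψ y) := by
  intro x
  have h1 : HasFDerivAt (fun y : ℂ => Real.exp (c * ‖y‖ ^ 2)) _ x :=
    (((hasStrictFDerivAt_norm_sq x).hasFDerivAt).const_mul c).exp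
  have h2 : HasFDerivAt (fun y : ℂ => (Real.exp (c * ‖y‖ ^ 2) : ℂ)) _ x :=
    Complex.ofRealCLM.hasFDerivAt.comp x h1
  exact (h2.mul (hψ x).hasFDerivAt).differentiableAt

/-- As 2∂̄(|x|²/4) = x/2, the weight turns the annihilation equation into the Cauchy–Riemann
equation. -/
theorem differentiable_of_annih_eq_zero {φ : ℂ → ℂ} (hφ : Differentiable ℝ φ)
    (h : ∀ x, annih φ x = 0) :
    Differentiable ℂ (fun y => (Real.exp (1 / 4 * ‖y‖ ^ 2) : ℂ) * φ y) := by
  intro x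
  rw [differentiableAt_complex_iff_differentiableAt_real]
  refine ⟨differentiable_exp_mul hφ _ x, ?_⟩
  rw [fderiv_exp_mul hφ, fderiv_exp_mul hφ]
  have hx := h x
  rw [annih, covDeriv_a0, covDeriv_a0] at hx
  simp at hx ⊢
  linear_combination (-Complex.I * Complex.exp (4⁻¹ * ‖x‖ ^ 2)) * hx
    + Complex.exp (4⁻¹ * ‖x‖ ^ 2) * (fderiv ℝ φ x Complex.I + x.im * φ x / 2
      - Complex.I * x.re * φ x / 2) * Complex.I_sq

theorem annih_exp_mul_eq_zero {f : ℂ → ℂ} (hf : Differentiable ℂ f) (x : ℂ) :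
    annih (fun y => (Real.exp (-(1 / 4) * ‖y‖ ^ 2) : ℂ) * f y) x = 0 := by
  have hf' : Differentiable ℝ f := hf.restrictScalars ℝ
  have h := (differentiableAt_complex_iff_differentiableAt_real.1 (hf x)).2
  rw [annih, covDeriv_a0, covDeriv_a0, fderiv_exp_mul hf', fderiv_exp_mul hf', h]
  simp
  linear_combination Complex.exp (-(4⁻¹ * ‖x‖ ^ 2)) * (fderiv ℝ f x 1 - x.re * f x / 2)
    * Complex.I_sq

/-! ### Solutions lie in the lowest Landau level -/

/-- A bounded function annihilated by the creation operator `-(2∂ - x̄/2)` vanishes. -/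
theorem eq_zero_of_creation_eq_zero {ψ : ℂ → ℂ} (hψ : Differentiable ℝ ψ) {C : ℝ}
    (hC : ∀ x, ‖ψ x‖ ≤ C)
    (h : ∀ x, covDeriv a0 1 ψ x - Complex.I * covDeriv a0 Complex.I ψ x = 0) (x : ℂ) :
    ψ x = 0 := by
  set g : ℂ → ℂ := fun y => conj ((Real.exp (-(1 / 4) * ‖y‖ ^ 2) : ℂ) * ψ y) with hg
  have hd := differentiable_exp_mul hψ (-(1 / 4))
  have hgd : ∀ x, HasFDerivAt g (Complex.conjCLE.toContinuousLinearMap.comp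
      (fderiv ℝ (fun y => (Real.exp (-(1 / 4) * ‖y‖ ^ 2) : ℂ) * ψ y) x)) x := fun x =>
    Complex.conjCLE.toContinuousLinearMap.hasFDerivAt.comp x (hd x).hasFDerivAt
  have hgc : Differentiable ℂ g := by
    intro x
    rw [differentiableAt_complex_iff_differentiableAt_real]
    refine ⟨(hgd x).differentiableAt, ?_⟩
    rw [(hgd x).fderiv]
    have hx := h x
    rw [covDeriv_a0, covDeriv_a0] at hx
    have key : fderiv ℝ (fun y => (Real.exp (-(1 / 4) * ‖y‖ ^ 2) : ℂ) * ψ y) x Complex.I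
        = -Complex.I * fderiv ℝ (fun y => (Real.exp (-(1 / 4) * ‖y‖ ^ 2) : ℂ) * ψ y) x 1 := by
      rw [fderiv_exp_mul hψ, fderiv_exp_mul hψ]
      simp at hx ⊢
      linear_combination (Complex.I * Complex.exp (-(4⁻¹ * ‖x‖ ^ 2))) * hx
        + Complex.exp (-(4⁻¹ * ‖x‖ ^ 2)) * (fderiv ℝ ψ x Complex.I - x.im * ψ x / 2
          - Complex.I * x.re * ψ x / 2) * Complex.I_sq
    simp only [ContinuousLinearMap.comp_apply]
    rw [key]
    simp
  have hlim : Filter.Tendsto g (Filter.cocompact ℂ) (nhds 0) := by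
    have h1 : Filter.Tendsto (fun y : ℂ => Real.exp (-(1 / 4) * ‖y‖ ^ 2) * C)
        (Filter.cocompact ℂ) (nhds 0) := by
      rw [← zero_mul C]
      refine Filter.Tendsto.mul_const C (Real.tendsto_exp_atBot.comp ?_)
      refine Filter.Tendsto.const_mul_atTop_of_neg (by norm_num) ?_
      exact (Filter.tendsto_pow_atTop two_ne_zero).comp (tendsto_norm_cocompact_atTop (E := ℂ))
    refine squeeze_zero_norm (fun y => ?_) h1
    rw [hg, RCLike.norm_conj, norm_mul, Complex.norm_real, Real.norm_of_nonneg (Real.exp_pos _).le]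
    exact mul_le_mul_of_nonneg_left (hC y) (Real.exp_pos _).le
  have h0 := hgc.apply_eq_of_tendsto_cocompact x hlim
  simpa [hg] using h0

theorem inner_J (s x : ℂ) : inner ℝ s (J x) = s.re * x.im - s.im * x.re := by
  simp [J, Complex.inner]
  ring

/-- Covariant derivatives commute with magnetic translations. -/
theorem covDeriv_a0_add {φ : ℂ → ℂ} (hφ : Differentiable ℝ φ) {s c : ℂ}
    (h : ∀ x, φ (x + s)
      = c * Complex.exp (Complex.I * (((1 / 2) * inner ℝ s (J x) : ℝ) : ℂ)) * φ x) (v x : ℂ) :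
    covDeriv a0 v φ (x + s)
      = c * Complex.exp (Complex.I * (((1 / 2) * inner ℝ s (J x) : ℝ) : ℂ))
        * covDeriv a0 v φ x := by
  set ℓ : ℂ →L[ℝ] ℂ := ((2⁻¹ : ℂ) * s.re) • (Complex.ofRealCLM.comp Complex.imCLM)
    - ((2⁻¹ : ℂ) * s.im) • (Complex.ofRealCLM.comp Complex.reCLM) with hl
  have hls : ∀ y : ℂ, (((1 / 2) * inner ℝ s (J y) : ℝ) : ℂ) = ℓ y := by
    intro y
    rw [inner_J, hl]
    simp
    ring
  have h1 : HasFDerivAt (fun y => c * Complex.exp (Complex.I * ℓ y) * φ y) _ x :=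
    (((ℓ.hasFDerivAt (x := x)).const_mul Complex.I).cexp.const_mul c).mul (hφ x).hasFDerivAt
  have h2 : fderiv ℝ φ (x + s) = fderiv ℝ (fun y => c * Complex.exp (Complex.I * ℓ y) * φ y) x := by
    rw [← fderiv_comp_add_right]
    congr 1
    funext y
    rw [h y, hls]
  rw [covDeriv_a0, covDeriv_a0, h2, h1.fderiv, h x, hls]
  simp [hl]
  ring

theorem annih_add {φ : ℂ → ℂ} (hφ : Differentiable ℝ φ) {s c : ℂ}
    (h : ∀ x, φ (x + s)
      = c * Complex.exp (Complex.I * (((1 / 2) * inner ℝ s (J x) : ℝ) : ℂ)) * φ x) (x : ℂ) :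
    annih φ (x + s)
      = c * Complex.exp (Complex.I * (((1 / 2) * inner ℝ s (J x) : ℝ) : ℂ)) * annih φ x := by
  rw [annih, annih, covDeriv_a0_add hφ h, covDeriv_a0_add hφ h]
  ring

theorem continuous_annih {φ : ℂ → ℂ} (hφ : ContDiff ℝ 2 φ) : Continuous (annih φ) :=
  (differentiable_annih hφ).continuous

theorem scale_pos {τ : ℂ} (hτ : 0 < τ.im) : 0 < Real.sqrt (2 * Real.pi / τ.im) := by
  have := Real.pi_pos
  positivity

theorem scale_sq {τ : ℂ} (hτ : 0 < τ.im) :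
    Real.sqrt (2 * Real.pi / τ.im) ^ 2 * τ.im = 2 * Real.pi := by
  have := Real.pi_pos
  rw [Real.sq_sqrt (by positivity)]
  field_simp

theorem point_re (τ : ℂ) (u v : ℝ) :
    (point τ u v).re = Real.sqrt (2 * Real.pi / τ.im) * (u + v * τ.re) := by
  simp [point]

theorem point_im (τ : ℂ) (u v : ℝ) :
    (point τ u v).im = Real.sqrt (2 * Real.pi / τ.im) * (v * τ.im) := by
  simp [point]

theorem exists_eq_point {τ : ℂ} (hτ : 0 < τ.im) (x : ℂ) : ∃ u v : ℝ, x = point τ u v := by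
  have ha := (scale_pos hτ).ne'
  have hτ' := hτ.ne'
  refine ⟨x.re / Real.sqrt (2 * Real.pi / τ.im)
    - x.im / (Real.sqrt (2 * Real.pi / τ.im) * τ.im) * τ.re,
    x.im / (Real.sqrt (2 * Real.pi / τ.im) * τ.im), ?_⟩
  apply Complex.ext
  · rw [point_re]
    field_simp
    ring
  · rw [point_im]
    field_simp

theorem point_add (τ : ℂ) (u v u' v' : ℝ) :
    point τ u v + point τ u' v' = point τ (u + u') (v + v') := by
  simp [point]
  ring

theorem exists_eq_point_add {τ : ℂ} (hτ : 0 < τ.im) (x : ℂ) :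
    ∃ u ∈ Set.Ico (0 : ℝ) 1, ∃ v ∈ Set.Ico (0 : ℝ) 1, ∃ m n : ℤ,
      x = point τ u v + point τ m n := by
  obtain ⟨u, v, rfl⟩ := exists_eq_point hτ x
  refine ⟨Int.fract u, ⟨Int.fract_nonneg u, Int.fract_lt_one u⟩, Int.fract v,
    ⟨Int.fract_nonneg v, Int.fract_lt_one v⟩, ⌊u⌋, ⌊v⌋, ?_⟩
  rw [point_add, Int.fract_add_floor, Int.fract_add_floor]

theorem continuous_point (τ : ℂ) : Continuous (fun p : ℝ × ℝ => point τ p.1 p.2) := by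
  unfold point
  fun_prop

theorem bounded_of_norm_periodic {τ : ℂ} (hτ : 0 < τ.im) {ψ : ℂ → ℂ} (hψ : Continuous ψ)
    (h : ∀ m n : ℤ, ∀ x, ‖ψ (x + point τ m n)‖ = ‖ψ x‖) : ∃ C : ℝ, ∀ x, ‖ψ x‖ ≤ C := by
  have hK : IsCompact (Set.Icc (0 : ℝ) 1 ×ˢ Set.Icc (0 : ℝ) 1) :=
    isCompact_Icc.prod isCompact_Icc
  obtain ⟨C, hC⟩ := hK.exists_bound_of_continuousOn
    (hψ.comp (continuous_point τ)).continuousOn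
  refine ⟨C, fun x => ?_⟩
  obtain ⟨u, hu, v, hv, m, n, rfl⟩ := exists_eq_point_add hτ x
  rw [h]
  exact hC (u, v) ⟨⟨hu.1, hu.2.le⟩, ⟨hv.1, hv.2.le⟩⟩

theorem norm_multiplier (j : ℤ) (r r' : ℝ) :
    ‖(-1 : ℂ) ^ j * Complex.exp (Complex.I * (r : ℂ)) * Complex.exp (Complex.I * (r' : ℂ))‖
      = 1 := by
  rw [mul_comm Complex.I, mul_comm Complex.I]
  simp [Complex.norm_exp_ofReal_mul_I]

/-- Normalized solutions lie in the lowest Landau level. -/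
theorem IsNormalizedSolution.annih_eq_zero {τ k : ℂ} (hτ : 0 < τ.im) {φ : ℂ → ℂ}
    (h : IsNormalizedSolution τ k φ) (x : ℂ) : annih φ x = 0 := by
  have hd : Differentiable ℝ φ := h.contDiff.differentiable (by norm_num)
  -- The sign and the quasimomentum phase do not depend on x, so both go into the constant `c` of
  -- `annih_add`.
  obtain ⟨C, hC⟩ := bounded_of_norm_periodic hτ (continuous_annih h.contDiff) (fun m n x => by
    rw [annih_add hd (s := point τ m n) (c := (-1 : ℂ) ^ (m * n)
      * Complex.exp (Complex.I * ((inner ℝ k (point τ m n) : ℝ) : ℂ))) (fun x => by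
        rw [h.quasiPeriodic]; ring), norm_mul, mul_right_comm, norm_multiplier, one_mul])
  refine eq_zero_of_creation_eq_zero (differentiable_annih h.contDiff) hC (fun x => ?_) x
  rw [← covLaplacian_a0_add_self h.contDiff]
  linear_combination -h.eigen x

/-! ### Functions with a theta translation law are determined by one integral -/

/-- Cauchy's theorem on a rectangle of width one: the vertical sides cancel by periodicity, so the
height is irrelevant. The real part of the shift is absorbed by periodicity on the line. -/
theorem intervalIntegral_add_eq_of_periodic {h : ℂ → ℂ} (hd : Differentiable ℂ h)
    (hp : ∀ z, h (z + 1) = h z) (w : ℂ) :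
    ∫ t in (0 : ℝ)..1, h (t + w) = ∫ t in (0 : ℝ)..1, h t := by
  have h1 := Complex.integral_boundary_rect_eq_zero_of_differentiableOn h 0 (1 + w.im * Complex.I)
    hd.differentiableOn
  have h2 : ∀ y : ℝ, h (1 + y * Complex.I) = h (y * Complex.I) := fun y => by
    rw [add_comm, hp]
  simp [h2] at h1
  have h3 : Function.Periodic (fun t : ℝ => h (t + w.im * Complex.I)) 1 := fun t => by
    beta_reduce
    rw [← hp (t + w.im * Complex.I)]
    push_cast
    ring_nf
  have h4 := h3.intervalIntegral_add_eq w.re 0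
  rw [zero_add] at h4
  rw [sub_eq_zero.1 h1, ← h4, ← zero_add w.re, add_comm (0 + w.re) 1, ← add_assoc,
    ← intervalIntegral.integral_comp_add_right]
  simp only [add_zero]
  congr 1
  funext t
  congr 1
  apply Complex.ext <;> simp

theorem eq_zero_of_fourier_integrals_eq_zero {g : ℝ → ℂ} (hg : Continuous g)
    (hp : Function.Periodic g 1)
    (h : ∀ n : ℤ, ∫ t in (0 : ℝ)..1, Complex.exp (-(2 * Real.pi * Complex.I * n * t)) * g t = 0)
    (t : ℝ) : g t = 0 := by
  have : Fact (0 < (1 : ℝ)) := ⟨one_pos⟩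
  let G : C(AddCircle (1 : ℝ), ℂ) := ⟨hp.lift, continuous_coinduced_dom.2 hg⟩
  have hc : ∀ n, fourierCoeff G n = 0 := by
    intro n
    rw [fourierCoeff_eq_intervalIntegral _ n 0]
    simp only [zero_add]
    have : ∀ t : ℝ, fourier (-n) (t : AddCircle (1 : ℝ)) • G t
        = Complex.exp (-(2 * Real.pi * Complex.I * n * t)) * g t := by
      intro t
      rw [fourier_coe_apply, smul_eq_mul]
      congr 2
      push_cast
      ring
    simp only [this, h n, smul_zero]
  have hs : Summable (fourierCoeff G) := by
    rw [funext hc]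
    exact summable_zero
  have := has_pointwise_sum_fourier_series_of_summable hs (t : AddCircle (1 : ℝ))
  simp only [hc, zero_smul] at this
  exact this.unique hasSum_zero

theorem theta_eq_zero_of_integral_eq_zero {Θ : ℂ → ℂ} (hd : Differentiable ℂ Θ) {τ C : ℂ}
    (h1 : ∀ z, Θ (z + 1) = Θ z)
    (h2 : ∀ z, Θ (z + τ) = C * Complex.exp (-(2 * Real.pi * Complex.I * z)) * Θ z) (hC : C ≠ 0)
    (h0 : ∫ t in (0 : ℝ)..1, Θ t = 0) (z : ℂ) : Θ z = 0 := by
  set c : ℤ → ℂ := fun n => ∫ t in (0 : ℝ)..1,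
    Complex.exp (-(2 * Real.pi * Complex.I * n * t)) * Θ t with hc
  have hent : ∀ n : ℤ, Differentiable ℂ
      (fun z => Complex.exp (-(2 * Real.pi * Complex.I * n * z)) * Θ z) := fun n => by fun_prop
  have hper : ∀ n : ℤ, ∀ z : ℂ, Complex.exp (-(2 * Real.pi * Complex.I * n * (z + 1))) * Θ (z + 1)
      = Complex.exp (-(2 * Real.pi * Complex.I * n * z)) * Θ z := by
    intro n z
    rw [h1, Complex.exp_eq_exp_iff_exists_int.2 ⟨-n, ?_⟩]
    push_cast
    ring
  have hrec : ∀ n, c n = Complex.exp (-(2 * Real.pi * Complex.I * n * τ)) * C * c (n + 1) := by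
    intro n
    simp only [hc]
    -- Evaluated along the line through τ, the translation law contributes a factor e^{-2πit}, which
    -- raises the frequency from n to n + 1.
    rw [← intervalIntegral_add_eq_of_periodic (hent n) (hper n) τ,
      ← intervalIntegral.integral_const_mul]
    congr 1
    funext t
    rw [h2, show -(2 * Real.pi * Complex.I * n * (t + τ)) = -(2 * Real.pi * Complex.I * n * τ)
      + -(2 * Real.pi * Complex.I * n * t) by ring, show
      -(2 * Real.pi * Complex.I * ((n + 1 : ℤ) : ℂ) * t) = -(2 * Real.pi * Complex.I * n * t)
        + -(2 * Real.pi * Complex.I * t) by push_cast; ring, Complex.exp_add, Complex.exp_add]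
    ring
  have hzero : ∀ n, c n = 0 := by
    intro n
    induction n using Int.induction_on with
    | zero => simpa [hc] using h0
    | succ n ih =>
      have := hrec n
      rw [ih] at this
      have := this.symm
      simpa [hC, Complex.exp_ne_zero] using this
    | pred n ih =>
      rw [hrec, sub_add_cancel, ih, mul_zero]
  -- Moving the contour shows that the coefficients also vanish on the horizontal line through z;
  -- the value at t = 0 is Θ z.
  have := eq_zero_of_fourier_integrals_eq_zero (g := fun t => Θ (t + z))
    (hd.continuous.comp (by fun_prop)) (fun t => by
      beta_reduce
      rw [← h1 (t + z)]
      push_cast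
      ring_nf) (fun n => by
      have := intervalIntegral_add_eq_of_periodic (hent n) (hper n) z
      have hn : ∫ t in (0 : ℝ)..1, Complex.exp (-(2 * Real.pi * Complex.I * n * t)) * Θ t = 0 :=
        hzero n
      rw [hn] at this
      rw [← mul_zero (Complex.exp (2 * Real.pi * Complex.I * n * z)), ← this,
        ← intervalIntegral.integral_const_mul]
      congr 1
      funext t
      rw [← mul_assoc, ← Complex.exp_add]
      ring_nf) 0
  simpa using this

/-! ### Passage to theta functions and uniqueness -/

/-- The factor relating a lowest Landau level function with quasimomentum `k` to its theta
function. -/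
noncomputable def gauge (k x : ℂ) : ℂ := (x ^ 2 - (‖x‖ ^ 2 : ℝ)) / 4 + Complex.I * k.re * x

theorem ofReal_normSq_eq (x : ℂ) : ((‖x‖ ^ 2 : ℝ) : ℂ) = (x.re : ℂ) ^ 2 + (x.im : ℂ) ^ 2 := by
  rw [← Complex.normSq_eq_norm_sq, Complex.normSq_apply]
  push_cast
  ring

/-- The exact multiplier of `exp (gauge k)` under lattice translations. -/
theorem gauge_add {τ : ℂ} (hτ : 0 < τ.im) (k x : ℂ) (m n : ℤ) :
    gauge k (x + point τ m n)
      = gauge k x + (Real.pi * Complex.I * (m * n) + Complex.I *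
        (((1 / 2) * inner ℝ (point τ m n) (J x) : ℝ) : ℂ) + Complex.I *
          ((inner ℝ k (point τ m n) : ℝ) : ℂ))
        + (Real.pi * Complex.I * n ^ 2 * τ + 2 * Real.pi * Complex.I * n *
          ((x + Complex.I * k) / (Real.sqrt (2 * Real.pi / τ.im) : ℂ))) := by
  have ha := (scale_pos hτ).ne'
  have hsq := scale_sq hτ
  rw [inner_J, Complex.inner]
  simp only [point, gauge, ofReal_normSq_eq]
  set a := Real.sqrt (2 * Real.pi / τ.im)
  have ha' : (a : ℂ) ≠ 0 := by exact_mod_cast ha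
  -- Eliminating π through the cell area a² Im τ = 2π leaves an algebraic identity in real
  -- coordinates.
  have hpi : (Real.pi : ℂ) = a ^ 2 * τ.im / 2 := by
    have : Real.pi = a ^ 2 * τ.im / 2 := by linarith
    exact_mod_cast this
  obtain ⟨x1, x2⟩ := x
  obtain ⟨k1, k2⟩ := k
  obtain ⟨t1, t2⟩ := τ
  rw [hpi]
  simp only [Complex.mk_eq_add_mul_I] at *
  simp
  field_simp
  ring_nf
  simp only [Complex.I_sq, Complex.I_pow_three]
  ring

/-- Completing the square: term j at the shifted point is term j + n at z times the automorphy
factor. -/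
theorem jacobiTheta₂_add_lattice (z τ : ℂ) (m n : ℤ) :
    jacobiTheta₂ (z + (m + n * τ)) τ
      = Complex.exp (-(Real.pi * Complex.I * n ^ 2 * τ + 2 * Real.pi * Complex.I * n * z))
        * jacobiTheta₂ z τ := by
  rw [jacobiTheta₂, jacobiTheta₂, ← Equiv.tsum_eq (Equiv.addRight n) (fun j =>
    jacobiTheta₂_term j z τ), ← tsum_mul_left]
  refine tsum_congr fun j => ?_
  rw [jacobiTheta₂_term, jacobiTheta₂_term, ← Complex.exp_add, Complex.exp_eq_exp_iff_exists_int]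
  refine ⟨j * m, ?_⟩
  simp
  ring

/-- The magnetic multiplier is the coboundary of e^{gauge} times a theta automorphy factor. This one
identity serves both the translation law of `thetaPart` and that of `landau`. -/
theorem multiplier_eq {τ : ℂ} (hτ : 0 < τ.im) (k x : ℂ) (m n : ℤ) :
    (-1 : ℂ) ^ (m * n)
        * Complex.exp (Complex.I * (((1 / 2) * inner ℝ (point τ m n) (J x) : ℝ) : ℂ))
        * Complex.exp (Complex.I * ((inner ℝ k (point τ m n) : ℝ) : ℂ))
      = Complex.exp (gauge k (x + point τ m n)) * Complex.exp (-gauge k x)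
        * Complex.exp (-(Real.pi * Complex.I * n ^ 2 * τ + 2 * Real.pi * Complex.I * n *
          ((x + Complex.I * k) / (Real.sqrt (2 * Real.pi / τ.im) : ℂ)))) := by
  rw [gauge_add hτ, ← Complex.exp_pi_mul_I, ← Complex.exp_int_mul, ← Complex.exp_add,
    ← Complex.exp_add, ← Complex.exp_add, ← Complex.exp_add]
  congr 1
  push_cast
  ring

/-- The theta function of a function on the plane. -/
noncomputable def thetaPart (τ k : ℂ) (φ : ℂ → ℂ) (z : ℂ) : ℂ :=
  Complex.exp (-gauge k ((Real.sqrt (2 * Real.pi / τ.im) : ℂ) * z))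
    * φ ((Real.sqrt (2 * Real.pi / τ.im) : ℂ) * z)

theorem differentiable_thetaPart (τ k : ℂ) {φ : ℂ → ℂ} (hd : Differentiable ℝ φ)
    (h : ∀ x, annih φ x = 0) : Differentiable ℂ (thetaPart τ k φ) := by
  have h1 := differentiable_of_annih_eq_zero hd h
  have h2 : thetaPart τ k φ = (fun x => Complex.exp (-(x ^ 2 / 4 + Complex.I * k.re * x))
      * ((fun y => (Real.exp (1 / 4 * ‖y‖ ^ 2) : ℂ) * φ y) x))
        ∘ (fun z => (Real.sqrt (2 * Real.pi / τ.im) : ℂ) * z) := by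
    funext z
    simp only [thetaPart, gauge, Function.comp, ← mul_assoc]
    rw [Complex.ofReal_exp, ← Complex.exp_add]
    congr 2
    push_cast
    ring
  rw [h2]
  exact Differentiable.comp (by fun_prop) (by fun_prop)

theorem IsNormalizedSolution.thetaPart_add {τ k : ℂ} (hτ : 0 < τ.im) {φ : ℂ → ℂ}
    (h : IsNormalizedSolution τ k φ) (z : ℂ) (m n : ℤ) :
    thetaPart τ k φ (z + (m + n * τ))
      = Complex.exp (-(Real.pi * Complex.I * n ^ 2 * τ + 2 * Real.pi * Complex.I * n *
          (z + Complex.I * k / (Real.sqrt (2 * Real.pi / τ.im) : ℂ)))) * thetaPart τ k φ z := by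
  have ha : ((Real.sqrt (2 * Real.pi / τ.im) : ℝ) : ℂ) ≠ 0 := by exact_mod_cast (scale_pos hτ).ne'
  have hs : (Real.sqrt (2 * Real.pi / τ.im) : ℂ) * (z + (m + n * τ))
      = (Real.sqrt (2 * Real.pi / τ.im) : ℂ) * z + point τ m n := by
    simp [point]
    ring
  have hz : ((Real.sqrt (2 * Real.pi / τ.im) : ℂ) * z + Complex.I * k)
      / (Real.sqrt (2 * Real.pi / τ.im) : ℂ)
        = z + Complex.I * k / (Real.sqrt (2 * Real.pi / τ.im) : ℂ) := by
    rw [add_div, mul_div_cancel_left₀ _ ha]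
  rw [thetaPart, thetaPart, hs, h.quasiPeriodic, multiplier_eq hτ, hz]
  rw [Complex.exp_neg (gauge k (_ + _))]
  field_simp [Complex.exp_ne_zero]

theorem IsNormalizedSolution.exists_ne_zero {τ k : ℂ} {φ : ℂ → ℂ}
    (h : IsNormalizedSolution τ k φ) : ∃ x, φ x ≠ 0 := by
  by_contra! h0
  have := h.normalized
  simp [h0] at this

theorem eq_exp_mul_thetaPart {τ : ℂ} (hτ : 0 < τ.im) (k : ℂ) (φ : ℂ → ℂ) (x : ℂ) :
    φ x = Complex.exp (gauge k x)
      * thetaPart τ k φ (x / (Real.sqrt (2 * Real.pi / τ.im) : ℂ)) := by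
  have ha : ((Real.sqrt (2 * Real.pi / τ.im) : ℝ) : ℂ) ≠ 0 := by exact_mod_cast (scale_pos hτ).ne'
  rw [thetaPart, mul_div_cancel₀ _ ha, ← mul_assoc, ← Complex.exp_add, add_neg_cancel,
    Complex.exp_zero, one_mul]

theorem eq_zero_of_theta_integral_eq_zero {τ : ℂ} {Θ : ℂ → ℂ} (b : ℂ)
    (hd : Differentiable ℂ Θ)
    (h : ∀ (z : ℂ) (m n : ℤ), Θ (z + (m + n * τ))
      = Complex.exp (-(Real.pi * Complex.I * n ^ 2 * τ + 2 * Real.pi * Complex.I * n *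
          (z + b))) * Θ z)
    (h0 : ∫ t in (0 : ℝ)..1, Θ t = 0) (z : ℂ) : Θ z = 0 := by
  refine theta_eq_zero_of_integral_eq_zero hd (τ := τ)
    (C := Complex.exp (-(Real.pi * Complex.I * τ + 2 * Real.pi * Complex.I * b)))
    (fun z => ?_) (fun z => ?_) (Complex.exp_ne_zero _) h0 z
  · simpa using h z 1 0
  · rw [← Complex.exp_add]
    convert h z 0 1 using 3 <;> push_cast <;> ring

theorem IsNormalizedSolution.unique {τ k : ℂ} (hτ : 0 < τ.im) {φ ψ : ℂ → ℂ}
    (hφ : IsNormalizedSolution τ k φ) (hψ : IsNormalizedSolution τ k ψ) :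
    ∃ c : ℂ, ‖c‖ = 1 ∧ ∀ x, ψ x = c * φ x := by
  have dφ := differentiable_thetaPart τ k (hφ.contDiff.differentiable (by norm_num))
    (hφ.annih_eq_zero hτ)
  have dψ := differentiable_thetaPart τ k (hψ.contDiff.differentiable (by norm_num))
    (hψ.annih_eq_zero hτ)
  set Iφ := ∫ t in (0 : ℝ)..1, thetaPart τ k φ t with hIφ
  set Iψ := ∫ t in (0 : ℝ)..1, thetaPart τ k ψ t with hIψ
  have hne : Iφ ≠ 0 := by
    intro h0
    obtain ⟨x, hx⟩ := hφ.exists_ne_zero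
    apply hx
    rw [eq_exp_mul_thetaPart hτ k φ x,
      eq_zero_of_theta_integral_eq_zero _ dφ (hφ.thetaPart_add hτ) h0, mul_zero]
  -- The weights make the integral over [0, 1] vanish, so the combination is zero.
  have hcomb : ∀ z, Iψ * thetaPart τ k φ z - Iφ * thetaPart τ k ψ z = 0 := by
    refine eq_zero_of_theta_integral_eq_zero (τ := τ)
      (Complex.I * k / (Real.sqrt (2 * Real.pi / τ.im) : ℂ))
      ((dφ.const_mul Iψ).sub (dψ.const_mul Iφ)) (fun z m n => ?_) ?_
    · rw [hφ.thetaPart_add hτ, hψ.thetaPart_add hτ]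
      ring
    · rw [intervalIntegral.integral_sub, intervalIntegral.integral_const_mul,
        intervalIntegral.integral_const_mul, ← hIφ, ← hIψ, mul_comm, sub_self]
      · exact ((dφ.continuous.comp Complex.continuous_ofReal).const_mul Iψ).intervalIntegrable _ _
      · exact ((dψ.continuous.comp Complex.continuous_ofReal).const_mul Iφ).intervalIntegrable _ _
  have heq : ∀ x, ψ x = Iψ / Iφ * φ x := by
    intro x
    rw [eq_exp_mul_thetaPart hτ k φ x, eq_exp_mul_thetaPart hτ k ψ x]
    have := hcomb (x / (Real.sqrt (2 * Real.pi / τ.im) : ℂ))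
    field_simp
    linear_combination -this
  refine ⟨Iψ / Iφ, ?_, heq⟩
  have h1 := hψ.normalized
  simp only [heq, norm_mul, mul_pow] at h1
  rw [average_eq, integral_const_mul, smul_eq_mul, mul_left_comm, ← smul_eq_mul (_⁻¹),
    ← average_eq, hφ.normalized, mul_one] at h1
  exact (pow_eq_one_iff_of_nonneg (norm_nonneg _) two_ne_zero).1 h1

/-! ### The explicit solution -/

/-- The explicit lowest Landau level function with quasimomentum `k`. -/
noncomputable def landau (τ k x : ℂ) : ℂ :=
  Complex.exp (gauge k x) * (((2 * τ.im) ^ (1 / 4 : ℝ) : ℝ)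
    * Complex.exp (-(k.re ^ 2 / 2) - Complex.I * k.re * k.im / 2)
    * jacobiTheta₂ ((x + Complex.I * k) / (Real.sqrt (2 * Real.pi / τ.im) : ℂ)) τ)

theorem landau_eq (τ k : ℂ) : ∃ f : ℂ → ℂ, (0 < τ.im → Differentiable ℂ f) ∧
    landau τ k = fun y => (Real.exp (-(1 / 4) * ‖y‖ ^ 2) : ℂ) * f y := by
  refine ⟨fun x => Complex.exp (x ^ 2 / 4 + Complex.I * k.re * x) *
    (((2 * τ.im) ^ (1 / 4 : ℝ) : ℝ)
    * Complex.exp (-(k.re ^ 2 / 2) - Complex.I * k.re * k.im / 2)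
    * jacobiTheta₂ ((x + Complex.I * k) / (Real.sqrt (2 * Real.pi / τ.im) : ℂ)) τ),
    fun hτ => ?_, ?_⟩
  · have h1 : Differentiable ℂ (fun z => jacobiTheta₂ z τ) :=
      fun z => differentiableAt_jacobiTheta₂_fst z hτ
    have h2 : Differentiable ℂ (fun x => jacobiTheta₂ ((x + Complex.I * k)
      / (Real.sqrt (2 * Real.pi / τ.im) : ℂ)) τ) := h1.comp (by fun_prop)
    fun_prop
  · funext x
    rw [landau, ← mul_assoc (Complex.ofReal _), Complex.ofReal_exp, ← Complex.exp_add, gauge]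
    congr 2
    push_cast
    ring

theorem contDiff_landau {τ : ℂ} (hτ : 0 < τ.im) (k : ℂ) : ContDiff ℝ 2 (landau τ k) := by
  obtain ⟨f, hf, he⟩ := landau_eq τ k
  rw [he]
  have h1 : ContDiff ℝ 2 (fun y : ℂ => Real.exp (-(1 / 4) * ‖y‖ ^ 2)) :=
    ((contDiff_norm_sq ℝ).const_smul (-(1 / 4) : ℝ)).exp
  exact (Complex.ofRealCLM.contDiff.comp h1).mul ((hf hτ).contDiff.restrict_scalars ℝ)

theorem eigen_landau {τ : ℂ} (hτ : 0 < τ.im) (k x : ℂ) :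
    -covLaplacian a0 (landau τ k) x - landau τ k x = 0 := by
  have h0 : annih (landau τ k) = fun _ => 0 := by
    funext y
    obtain ⟨f, hf, he⟩ := landau_eq τ k
    rw [he]
    exact annih_exp_mul_eq_zero (hf hτ) y
  have := covLaplacian_a0_add_self (contDiff_landau hτ k) x
  rw [h0] at this
  simp [covDeriv] at this
  linear_combination -this

theorem landau_add {τ : ℂ} (hτ : 0 < τ.im) (k x : ℂ) (m n : ℤ) :
    landau τ k (x + point τ m n) =
      (-1 : ℂ) ^ (m * n)
        * Complex.exp (Complex.I * (((1 / 2) * inner ℝ (point τ m n) (J x) : ℝ) : ℂ))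
        * Complex.exp (Complex.I * ((inner ℝ k (point τ m n) : ℝ) : ℂ)) * landau τ k x := by
  have ha : ((Real.sqrt (2 * Real.pi / τ.im) : ℝ) : ℂ) ≠ 0 := by exact_mod_cast (scale_pos hτ).ne'
  have hz : (x + point τ m n + Complex.I * k) / (Real.sqrt (2 * Real.pi / τ.im) : ℂ)
      = (x + Complex.I * k) / (Real.sqrt (2 * Real.pi / τ.im) : ℂ) + (m + n * τ) := by
    simp only [point]
    field_simp
    push_cast
    ring
  rw [multiplier_eq hτ, landau, landau, hz, jacobiTheta₂_add_lattice, Complex.exp_neg (gauge k x)]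
  field_simp [Complex.exp_ne_zero]

/-! ### The dual lattice and Gaussian summability -/

/-- The point of the dual lattice pairing to `2π m` and `2π l` with the two generators. -/
noncomputable def dualPoint (τ : ℂ) (p : ℤ × ℤ) : ℂ :=
  Complex.I * (Real.sqrt (2 * Real.pi / τ.im) : ℂ) * (p.2 - p.1 * τ)

theorem dualPoint_re (τ : ℂ) (p : ℤ × ℤ) :
    (dualPoint τ p).re = Real.sqrt (2 * Real.pi / τ.im) * (p.1 * τ.im) := by
  simp [dualPoint]

theorem dualPoint_im (τ : ℂ) (p : ℤ × ℤ) :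
    (dualPoint τ p).im = Real.sqrt (2 * Real.pi / τ.im) * (p.2 - p.1 * τ.re) := by
  simp [dualPoint]

theorem dualPoint_zero (τ : ℂ) : dualPoint τ 0 = 0 := by simp [dualPoint]

theorem dualPoint_neg (τ : ℂ) (p : ℤ × ℤ) : dualPoint τ (-p) = -dualPoint τ p := by
  simp [dualPoint]
  ring

theorem dualPoint_add (τ : ℂ) (p q : ℤ × ℤ) :
    dualPoint τ (p + q) = dualPoint τ p + dualPoint τ q := by
  simp [dualPoint]
  ring

theorem inner_dualPoint {τ : ℂ} (hτ : 0 < τ.im) (p : ℤ × ℤ) (u v : ℝ) :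
    (inner ℝ (dualPoint τ p) (point τ u v) : ℝ) = 2 * Real.pi * (p.1 * u + p.2 * v) := by
  rw [Complex.inner, ← scale_sq hτ]
  simp [dualPoint, point]
  ring

theorem dualPoint_injective {τ : ℂ} (hτ : 0 < τ.im) : Function.Injective (dualPoint τ) := by
  intro p q h
  have hpi := Real.pi_ne_zero
  have h1 := inner_dualPoint hτ p 1 0
  have h2 := inner_dualPoint hτ p 0 1
  rw [h, inner_dualPoint hτ] at h1 h2
  simp [hpi] at h1 h2
  exact Prod.ext h1.symm h2.symm

theorem range_dualPoint {τ : ℂ} (hτ : 0 < τ.im) : Set.range (dualPoint τ) = dualLattice τ := by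
  ext t
  constructor
  · rintro ⟨p, rfl⟩ s ⟨m, n, rfl⟩
    refine ⟨p.1 * m + p.2 * n, ?_⟩
    rw [inner_dualPoint hτ]
    push_cast
    ring
  · intro ht
    obtain ⟨m, hm⟩ := ht (point τ 1 0) ⟨1, 0, by simp⟩
    obtain ⟨l, hl⟩ := ht (point τ 0 1) ⟨0, 1, by simp⟩
    refine ⟨(m, l), ?_⟩
    have ha := (scale_pos hτ).ne'
    have hsq := scale_sq hτ
    rw [Complex.inner] at hm hl
    rw [← hsq] at hm hl
    simp [point] at hm hl
    have h1 : t.re = Real.sqrt (2 * Real.pi / τ.im) * (m * τ.im) := by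
      apply mul_left_cancel₀ ha
      linear_combination hm
    apply Complex.ext
    · rw [dualPoint_re, h1]
    · rw [dualPoint_im]
      rw [h1] at hl
      apply mul_left_cancel₀ ha
      apply mul_left_cancel₀ hτ.ne'
      simp only
      linear_combination -hl

/-- The dual lattice is indexed by pairs of integers. -/
noncomputable def dualEquiv {τ : ℂ} (hτ : 0 < τ.im) : ℤ × ℤ ≃ dualLattice τ :=
  (Equiv.ofInjective _ (dualPoint_injective hτ)).trans (Equiv.setCongr (range_dualPoint hτ))

theorem coe_dualEquiv {τ : ℂ} (hτ : 0 < τ.im) (p : ℤ × ℤ) :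
    (dualEquiv hτ p : ℂ) = dualPoint τ p := rfl

theorem summable_exp_neg_mul_sq {c : ℝ} (hc : 0 < c) :
    Summable (fun n : ℤ => Real.exp (-c * (n : ℝ) ^ 2)) := by
  -- At z = 0 and parameter ic/π, the theta terms have norm e^{-cn²}.
  have h := (summable_jacobiTheta₂_term_iff 0 (Complex.I * (c / Real.pi : ℝ))).2 (by
    simp
    have := Real.pi_pos
    positivity)
  refine h.norm.congr fun n => ?_
  rw [norm_jacobiTheta₂_term]
  simp
  field_simp

theorem sq_add_sq_le_norm_dualPoint {τ : ℂ} (hτ : 0 < τ.im) :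
    ∃ K : ℝ, 0 < K ∧ ∀ p : ℤ × ℤ,
      (p.1 : ℝ) ^ 2 + (p.2 : ℝ) ^ 2 ≤ K * ‖dualPoint τ p‖ ^ 2 := by
  have ha := scale_pos hτ
  set a := Real.sqrt (2 * Real.pi / τ.im) with haa
  -- For t = `dualPoint τ p`, p₁ = Re t / (a Im τ) and p₂ = Im t / a + p₁ Re τ; the constant comes
  -- from bounding p₂² by twice the sum of squares.
  refine ⟨(1 + 2 * τ.re ^ 2) / (a ^ 2 * τ.im ^ 2) + 2 / a ^ 2, by positivity, fun p => ?_⟩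
  rw [← Complex.normSq_eq_norm_sq, Complex.normSq_apply, dualPoint_re, dualPoint_im, ← haa]
  have h1 : ((1 + 2 * τ.re ^ 2) / (a ^ 2 * τ.im ^ 2) + 2 / a ^ 2)
      * (a * (p.1 * τ.im) * (a * (p.1 * τ.im))
        + a * (p.2 - p.1 * τ.re) * (a * (p.2 - p.1 * τ.re)))
      = (1 + 2 * τ.re ^ 2) * p.1 ^ 2 + 2 * (p.2 - p.1 * τ.re) ^ 2 + 2 * (p.1 * τ.im) ^ 2
        + (1 + 2 * τ.re ^ 2) / τ.im ^ 2 * (p.2 - p.1 * τ.re) ^ 2 := by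
    field_simp
    ring
  rw [h1]
  have h2 : 0 ≤ (1 + 2 * τ.re ^ 2) / τ.im ^ 2 * (p.2 - p.1 * τ.re) ^ 2 := by positivity
  nlinarith [sq_nonneg (p.1 * τ.im : ℝ), sq_nonneg ((p.2 : ℝ) - 2 * (p.1 * τ.re))]

theorem summable_exp_dualPoint {τ : ℂ} (hτ : 0 < τ.im) (k : ℂ) {c : ℝ} (hc : 0 < c) :
    Summable (fun p : ℤ × ℤ => Real.exp (-c * ‖dualPoint τ p + k‖ ^ 2)) := by
  obtain ⟨K, hK, h⟩ := sq_add_sq_le_norm_dualPoint hτ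
  have hs := summable_exp_neg_mul_sq (c := c / (2 * K)) (by positivity)
  refine Summable.of_nonneg_of_le (fun _ => (Real.exp_pos _).le) (fun p => ?_)
    ((hs.mul_of_nonneg hs (fun _ => (Real.exp_pos _).le)
      (fun _ => (Real.exp_pos _).le)).mul_left (Real.exp (c * ‖k‖ ^ 2)))
  rw [← Real.exp_add, ← Real.exp_add, Real.exp_le_exp]
  have h1 : ‖dualPoint τ p‖ ^ 2 ≤ 2 * ‖dualPoint τ p + k‖ ^ 2 + 2 * ‖k‖ ^ 2 := by
    have := norm_sub_le (dualPoint τ p + k) k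
    rw [add_sub_cancel_right] at this
    nlinarith [norm_nonneg (dualPoint τ p), sq_nonneg (‖dualPoint τ p + k‖ - ‖k‖)]
  have h2 := h p
  have h3 : c / (2 * K) * ((p.1 : ℝ) ^ 2 + (p.2 : ℝ) ^ 2) ≤ c / 2 * ‖dualPoint τ p‖ ^ 2 := by
    calc _ ≤ c / (2 * K) * (K * ‖dualPoint τ p‖ ^ 2) := by gcongr
      _ = _ := by field_simp
  nlinarith

/-! ### Fourier expansions of products -/

/-- The change of summation indices `(m, n) ↦ (n, m - n)`. -/
def shear : ℤ × ℤ ≃ ℤ × ℤ where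
  toFun q := (q.2, q.1 - q.2)
  invFun q := (q.1 + q.2, q.1)
  left_inv q := by simp
  right_inv q := by simp

/-- With indices n and m - n, n²τ - (m - n)²τ̄ = n²(τ - τ̄) + 2mnτ̄ - m²τ̄, so the sum over n is a
theta series with purely imaginary parameter. -/
theorem theta_mul_theta {τ : ℂ} (hτ : 0 < τ.im) (z w : ℂ) :
    jacobiTheta₂ z τ * jacobiTheta₂ w (-conj τ)
      = ∑' m : ℤ, Complex.exp (2 * Real.pi * Complex.I * m * w
          - Real.pi * Complex.I * m ^ 2 * conj τ)
        * jacobiTheta₂ (z - w + m * conj τ) (2 * Complex.I * τ.im) := by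
  have hτ' : 0 < (-conj τ).im := by simpa using hτ
  have hT : τ - conj τ = 2 * Complex.I * τ.im := by
    rw [Complex.sub_conj]
    push_cast
    ring
  have hs1 := ((summable_jacobiTheta₂_term_iff z τ).2 hτ).norm
  have hs2 := ((summable_jacobiTheta₂_term_iff w (-conj τ)).2 hτ').norm
  rw [jacobiTheta₂, jacobiTheta₂, tsum_mul_tsum_of_summable_norm hs1 hs2]
  have hs := shear.summable_iff.2 (summable_mul_of_summable_norm hs1 hs2)
  simp only [Function.comp_def] at hs
  rw [← shear.tsum_eq, Summable.tsum_prod hs]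
  refine tsum_congr fun m => ?_
  rw [jacobiTheta₂, ← tsum_mul_left]
  refine tsum_congr fun n => ?_
  simp only [shear, Equiv.coe_fn_mk, jacobiTheta₂_term, ← Complex.exp_add]
  congr 1
  push_cast
  rw [← hT]
  ring

/-- Jacobi's functional equation (Poisson summation) produces the second dual-lattice index l. -/
theorem theta_gaussian {s : ℝ} (hs : 0 < s) (ζ : ℂ) :
    ((2 * s) ^ (1 / 2 : ℝ) : ℝ) * jacobiTheta₂ ζ (2 * Complex.I * s)
      = ∑' l : ℤ, Complex.exp (-(Real.pi * (ζ - l) ^ 2 / (2 * s))) := by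
  have hs' : (s : ℂ) ≠ 0 := by exact_mod_cast hs.ne'
  rw [jacobiTheta₂_functional_equation]
  have h1 : -Complex.I * (2 * Complex.I * s) = ((2 * s : ℝ) : ℂ) := by
    push_cast
    linear_combination (-2 * s : ℂ) * Complex.I_sq
  have h2 : ((2 * s : ℝ) : ℂ) ^ (1 / 2 : ℂ) = ((2 * s) ^ (1 / 2 : ℝ) : ℝ) := by
    rw [Complex.ofReal_cpow (by positivity)]
    norm_num
  have h3 : (((2 * s) ^ (1 / 2 : ℝ) : ℝ) : ℂ) ≠ 0 := by
    exact_mod_cast (Real.rpow_pos_of_pos (by positivity) _).ne'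
  rw [h1, h2, mul_assoc (1 / _), ← mul_assoc, mul_one_div_cancel h3, one_mul, jacobiTheta₂,
    ← tsum_mul_left]
  refine tsum_congr fun l => ?_
  rw [jacobiTheta₂_term, ← Complex.exp_add]
  congr 1
  field_simp
  ring

/-- The plane wave of the dual lattice point with coordinates `p`. -/
noncomputable def wave (τ : ℂ) (p : ℤ × ℤ) (x : ℂ) : ℂ :=
  Complex.exp (Complex.I * ((inner ℝ (dualPoint τ p) x : ℝ) : ℂ))

/-- The Fourier coefficients of `e^{i k · x} φ₀ φ̄_k`. -/
noncomputable def coef (τ k : ℂ) (p : ℤ × ℤ) : ℂ :=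
  (-1 : ℂ) ^ (p.1 * p.2) * Complex.exp (((-(1 / 4) * ‖dualPoint τ p - k‖ ^ 2 : ℝ) : ℂ)
    + Complex.I * (((conj k * dualPoint τ p).im / 2 : ℝ) : ℂ))

theorem norm_wave (τ : ℂ) (p : ℤ × ℤ) (x : ℂ) : ‖wave τ p x‖ = 1 := by
  rw [wave, mul_comm, Complex.norm_exp_ofReal_mul_I]

theorem norm_coef (τ k : ℂ) (p : ℤ × ℤ) :
    ‖coef τ k p‖ = Real.exp (-(1 / 4) * ‖dualPoint τ p - k‖ ^ 2) := by
  rw [coef, norm_mul, Complex.exp_add, norm_mul, mul_comm Complex.I,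
    Complex.norm_exp_ofReal_mul_I, ← Complex.ofReal_exp, Complex.norm_real,
    Real.norm_of_nonneg (Real.exp_pos _).le]
  simp

theorem summable_norm_coef {τ : ℂ} (hτ : 0 < τ.im) (k : ℂ) :
    Summable (fun p => ‖coef τ k p‖) := by
  simp only [norm_coef, sub_eq_add_neg]
  exact summable_exp_dualPoint hτ (-k) (by norm_num)

/-- The left side collects every exponent left by the two resummations; completing the square gives
sign, coefficient and plane wave of the dual point (m, l). -/
theorem exponent_identity {τ : ℂ} (hτ : 0 < τ.im) (k x : ℂ) (m l : ℤ) :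
    Complex.I * ((inner ℝ k x : ℝ) : ℂ) + gauge 0 x + conj (gauge k x)
      + conj (-(k.re ^ 2 / 2) - Complex.I * k.re * k.im / 2)
      + (2 * Real.pi * Complex.I * m * conj ((x + Complex.I * k)
          / (Real.sqrt (2 * Real.pi / τ.im) : ℂ)) - Real.pi * Complex.I * m ^ 2 * conj τ)
      - Real.pi * (x / (Real.sqrt (2 * Real.pi / τ.im) : ℂ) - conj ((x + Complex.I * k)
          / (Real.sqrt (2 * Real.pi / τ.im) : ℂ)) + m * conj τ - l) ^ 2 / (2 * τ.im)
    = -(Real.pi * Complex.I * (m * l)) + (((-(1 / 4) * ‖dualPoint τ (m, l) - k‖ ^ 2 : ℝ) : ℂ)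
      + Complex.I * (((conj k * dualPoint τ (m, l)).im / 2 : ℝ) : ℂ))
      + Complex.I * ((inner ℝ (dualPoint τ (m, l)) x : ℝ) : ℂ) := by
  have ha := (scale_pos hτ).ne'
  have hsq := scale_sq hτ
  rw [Complex.inner, Complex.inner, Complex.ofReal_mul, ofReal_normSq_eq]
  simp only [dualPoint, gauge, ofReal_normSq_eq]
  set a := Real.sqrt (2 * Real.pi / τ.im)
  have ha' : (a : ℂ) ≠ 0 := by exact_mod_cast ha
  have hpi : (Real.pi : ℂ) = a ^ 2 * τ.im / 2 := by
    have : Real.pi = a ^ 2 * τ.im / 2 := by linarith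
    exact_mod_cast this
  obtain ⟨x1, x2⟩ := x
  obtain ⟨k1, k2⟩ := k
  obtain ⟨t1, t2⟩ := τ
  have ht : (t2 : ℂ) ≠ 0 := by exact_mod_cast hτ.ne'
  rw [hpi]
  simp only [Complex.mk_eq_add_mul_I] at *
  simp only [map_add, map_sub, map_mul, map_div₀, map_pow, map_neg, Complex.conj_ofReal,
    Complex.conj_I, map_ofNat]
  simp
  field_simp
  ring_nf
  simp only [Complex.I_sq, Complex.I_pow_three, Complex.I_pow_four]
  ring

theorem neg_one_zpow_eq_exp (j : ℤ) : (-1 : ℂ) ^ j = Complex.exp (-(Real.pi * Complex.I * j)) := by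
  rw [← neg_mul, mul_comm, Complex.exp_int_mul, Complex.exp_neg, Complex.exp_pi_mul_I]
  norm_num

theorem summable_coef_mul_wave {τ : ℂ} (hτ : 0 < τ.im) (k x : ℂ) :
    Summable (fun p => coef τ k p * wave τ p x) := by
  refine Summable.of_norm ?_
  simpa [norm_wave] using summable_norm_coef hτ k

theorem hasSum_landau_zero_mul_conj {τ : ℂ} (hτ : 0 < τ.im) (k x : ℂ) :
    HasSum (fun p => coef τ k p * wave τ p x)
      (Complex.exp (Complex.I * ((inner ℝ k x : ℝ) : ℂ)) * landau τ 0 x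
        * conj (landau τ k x)) := by
  have hs := summable_coef_mul_wave hτ k x
  convert hs.hasSum using 1
  rw [hs.tsum_prod]
  -- The two normalizing constants multiply to exactly the factor absorbed by `theta_gaussian`.
  have hc : ((((2 * τ.im) ^ (1 / 4 : ℝ) : ℝ) : ℂ)) * (((2 * τ.im) ^ (1 / 4 : ℝ) : ℝ) : ℂ)
      = (((2 * τ.im) ^ (1 / 2 : ℝ) : ℝ) : ℂ) := by
    rw [← Complex.ofReal_mul, ← Real.rpow_add (by positivity)]
    norm_num
  have h1 : Complex.exp (Complex.I * ((inner ℝ k x : ℝ) : ℂ)) * landau τ 0 x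
        * conj (landau τ k x)
      = Complex.exp (Complex.I * ((inner ℝ k x : ℝ) : ℂ) + gauge 0 x + conj (gauge k x)
          + conj (-(k.re ^ 2 / 2) - Complex.I * k.re * k.im / 2))
        * (((2 * τ.im) ^ (1 / 2 : ℝ) : ℝ)
        * (jacobiTheta₂ (x / (Real.sqrt (2 * Real.pi / τ.im) : ℂ)) τ
          * jacobiTheta₂ (conj ((x + Complex.I * k)
            / (Real.sqrt (2 * Real.pi / τ.im) : ℂ))) (-conj τ))) := by
    rw [← jacobiTheta₂_conj, ← hc, Complex.exp_add, Complex.exp_add, Complex.exp_add,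
      Complex.exp_conj, Complex.exp_conj]
    simp only [landau, map_mul, Complex.conj_ofReal, mul_zero, add_zero, Complex.zero_re,
      Complex.zero_im, Complex.ofReal_zero]
    simp
    ring
  rw [h1, theta_mul_theta hτ, ← tsum_mul_left, ← tsum_mul_left]
  refine tsum_congr fun m => ?_
  rw [mul_left_comm (Complex.ofReal _), theta_gaussian hτ, ← tsum_mul_left, ← tsum_mul_left]
  refine tsum_congr fun l => ?_
  rw [coef, wave, neg_one_zpow_eq_exp, ← Complex.exp_add, ← Complex.exp_add, ← Complex.exp_add,
    ← Complex.exp_add]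
  push_cast
  have := exponent_identity hτ k x m l
  push_cast at this
  rw [← this]
  congr 1
  ring

/-- The factor e^{-(Re k)²/2} in `landau` completes the square in the real part of the gauge
exponent. -/
theorem norm_landau (τ k x : ℂ) : ‖landau τ k x‖ = ‖landau τ 0 (x + Complex.I * k)‖ := by
  simp only [landau, mul_zero, add_zero, Complex.zero_re, Complex.zero_im, Complex.ofReal_zero]
  have h : ∀ r : ℝ, ∀ t : ℂ, ∀ u v : ℂ, ‖Complex.exp u * (r * Complex.exp v * t)‖
      = Real.exp (u.re + v.re) * (|r| * ‖t‖) := by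
    intro r t u v
    simp [Complex.norm_exp, Real.exp_add]
    ring
  rw [h, h]
  congr 2
  have hre : ∀ k x : ℂ, (gauge k x).re = -(x.im ^ 2) / 2 - k.re * x.im := by
    intro k x
    rw [gauge, ofReal_normSq_eq]
    simp [pow_two]
    ring
  rw [hre, hre]
  simp [pow_two]
  ring

/-- The Fourier expansion of `|φ_k|²`. -/
theorem hasSum_norm_landau_sq {τ : ℂ} (hτ : 0 < τ.im) (k x : ℂ) :
    HasSum (fun p => coef τ 0 p * wave τ p (Complex.I * k) * wave τ p x)
      ((‖landau τ k x‖ ^ 2 : ℝ) : ℂ) := by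
  have h := hasSum_landau_zero_mul_conj hτ 0 (x + Complex.I * k)
  simp only [inner_zero_left, Complex.ofReal_zero, mul_zero, Complex.exp_zero, one_mul,
    Complex.mul_conj, Complex.normSq_eq_norm_sq, ← norm_landau τ k x] at h
  convert h using 2 with p
  rw [mul_assoc]
  congr 1
  rw [wave, wave, wave, ← Complex.exp_add, inner_add_right]
  congr 1
  push_cast
  ring

/-! ### Means over the cell and Parseval's identity -/

/-- The real-linear map sending the unit square onto the cell. -/
noncomputable def cellMap (τ : ℂ) : ℂ →L[ℝ] ℂ :=
  (Real.sqrt (2 * Real.pi / τ.im) : ℂ) •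
    (Complex.ofRealCLM.comp Complex.reCLM + τ • Complex.ofRealCLM.comp Complex.imCLM)

theorem cellMap_apply (τ z : ℂ) : cellMap τ z = point τ z.re z.im := by
  simp [cellMap, point]
  ring

theorem cellMap_injective {τ : ℂ} (hτ : 0 < τ.im) : Function.Injective (cellMap τ) := by
  rw [injective_iff_map_eq_zero]
  intro z hz
  rw [cellMap_apply] at hz
  have h1 := congrArg Complex.im hz
  have h2 := congrArg Complex.re hz
  rw [point_im] at h1
  rw [point_re] at h2
  have hv : z.im = 0 := by simpa [(scale_pos hτ).ne', hτ.ne'] using h1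
  have hu : z.re = 0 := by simpa [hv, (scale_pos hτ).ne'] using h2
  exact Complex.ext hu hv

/-- The determinant cancels in mean values, so its value is not needed. -/
theorem cellMap_det_ne_zero {τ : ℂ} (hτ : 0 < τ.im) : (cellMap τ).det ≠ 0 := by
  intro h
  have h1 : LinearMap.ker (cellMap τ : ℂ →ₗ[ℝ] ℂ) = ⊥ :=
    LinearMap.ker_eq_bot.2 (cellMap_injective hτ)
  exact (LinearMap.bot_lt_ker_of_det_eq_zero h).ne' h1

theorem cell_eq_image (τ : ℂ) :
    cell τ = cellMap τ '' (Set.Ico (0 : ℝ) 1 ×ℂ Set.Ico (0 : ℝ) 1) := by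
  ext x
  constructor
  · rintro ⟨u, hu, v, hv, rfl⟩
    exact ⟨⟨u, v⟩, ⟨hu, hv⟩, cellMap_apply τ _⟩
  · rintro ⟨z, hz, rfl⟩
    exact ⟨z.re, hz.1, z.im, hz.2, cellMap_apply τ z⟩

/-- Integration over the unit square. -/
noncomputable def squareMeasure : Measure (ℝ × ℝ) :=
  (volume.restrict (Set.Ico (0 : ℝ) 1)).prod (volume.restrict (Set.Ico (0 : ℝ) 1))

instance : IsProbabilityMeasure (volume.restrict (Set.Ico (0 : ℝ) 1)) := ⟨by simp⟩

instance : IsProbabilityMeasure squareMeasure := by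
  unfold squareMeasure
  infer_instance

theorem integral_cell {E : Type*} [NormedAddCommGroup E] [NormedSpace ℝ E] {τ : ℂ}
    (hτ : 0 < τ.im) (g : ℂ → E) :
    ∫ x in cell τ, g x = |(cellMap τ).det| • ∫ p, g (point τ p.1 p.2) ∂squareMeasure := by
  have hm : MeasurableSet (Set.Ico (0 : ℝ) 1 ×ℂ Set.Ico (0 : ℝ) 1) :=
    (Complex.measurable_re measurableSet_Ico).inter (Complex.measurable_im measurableSet_Ico)
  rw [cell_eq_image, integral_image_eq_integral_abs_det_fderiv_smul volume hm
    (fun x _ => (cellMap τ).hasFDerivAt.hasFDerivWithinAt) (cellMap_injective hτ).injOn,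
    integral_smul, squareMeasure, Measure.prod_restrict]
  congr 1
  rw [← (Complex.volume_preserving_equiv_real_prod.symm).setIntegral_preimage_emb
    Complex.measurableEquivRealProd.symm.measurableEmbedding]
  congr 1
  funext p
  simp [cellMap_apply, Complex.measurableEquivRealProd_symm_apply]

theorem average_cell {E : Type*} [NormedAddCommGroup E] [NormedSpace ℝ E] [CompleteSpace E]
    {τ : ℂ} (hτ : 0 < τ.im) (g : ℂ → E) :
    ⨍ x in cell τ, g x = ∫ p, g (point τ p.1 p.2) ∂squareMeasure := by
  have h1 : volume.real (cell τ) = |(cellMap τ).det| := by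
    have := integral_cell hτ (fun _ => (1 : ℝ))
    simpa using this
  rw [setAverage_eq, integral_cell hτ, smul_smul, h1, inv_mul_cancel₀
    (abs_ne_zero.2 (cellMap_det_ne_zero hτ)), one_smul]

theorem integral_exp_int (m : ℤ) :
    ∫ u in Set.Ico (0 : ℝ) 1, Complex.exp (2 * Real.pi * Complex.I * m * u)
      = if m = 0 then 1 else 0 := by
  rw [integral_Ico_eq_integral_Ioc, ← intervalIntegral.integral_of_le zero_le_one]
  split_ifs with h
  · simp [h]
  · have hc : 2 * Real.pi * Complex.I * m ≠ 0 := by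
      simp [Real.pi_ne_zero, h]
    rw [integral_exp_mul_complex hc]
    simp only [Complex.ofReal_one, mul_one, Complex.ofReal_zero, mul_zero, Complex.exp_zero]
    rw [mul_comm _ (m : ℂ), Complex.exp_int_mul_two_pi_mul_I, sub_self, zero_div]

theorem integral_wave {τ : ℂ} (hτ : 0 < τ.im) (p : ℤ × ℤ) :
    ∫ q, wave τ p (point τ q.1 q.2) ∂squareMeasure = if p = 0 then 1 else 0 := by
  have h : ∀ q : ℝ × ℝ, wave τ p (point τ q.1 q.2)
      = Complex.exp (2 * Real.pi * Complex.I * p.1 * q.1)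
        * Complex.exp (2 * Real.pi * Complex.I * p.2 * q.2) := by
    intro q
    rw [wave, inner_dualPoint hτ, ← Complex.exp_add]
    congr 1
    push_cast
    ring
  simp only [h]
  rw [squareMeasure, integral_prod_mul
    (fun u : ℝ => Complex.exp (2 * Real.pi * Complex.I * p.1 * u))
    (fun u : ℝ => Complex.exp (2 * Real.pi * Complex.I * p.2 * u)), integral_exp_int,
    integral_exp_int]
  obtain ⟨m, l⟩ := p
  by_cases h1 : m = 0 <;> by_cases h2 : l = 0 <;> simp [h1, h2]

theorem wave_add (τ : ℂ) (p q : ℤ × ℤ) (x : ℂ) : wave τ (p + q) x = wave τ p x * wave τ q x := by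
  rw [wave, wave, wave, ← Complex.exp_add, dualPoint_add, inner_add_left]
  congr 1
  push_cast
  ring

theorem continuous_wave (τ : ℂ) (p : ℤ × ℤ) : Continuous (wave τ p) := by
  unfold wave
  fun_prop

/-- Parseval's identity for absolutely convergent Fourier series on the cell. -/
theorem hasSum_average_mul {τ : ℂ} (hτ : 0 < τ.im) {A B : ℤ × ℤ → ℂ} {U V : ℂ → ℂ}
    (hA : Summable (fun p => ‖A p‖)) (hB : Summable (fun p => ‖B p‖))
    (hU : ∀ x, HasSum (fun p => A p * wave τ p x) (U x))
    (hV : ∀ x, HasSum (fun p => B p * wave τ p x) (V x)) :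
    HasSum (fun p => A p * B (-p)) (⨍ x in cell τ, U x * V x) := by
  have hABn := hA.mul_norm hB
  set F : (ℤ × ℤ) × (ℤ × ℤ) → ℝ × ℝ → ℂ := fun r q =>
    A r.1 * B r.2 * wave τ (r.1 + r.2) (point τ q.1 q.2) with hF
  have hnorm : ∀ r q, ‖F r q‖ = ‖A r.1 * B r.2‖ := by
    intro r q
    rw [hF]
    simp [norm_wave]
  have hint : ∀ r, Integrable (F r) squareMeasure := by
    intro r
    refine (integrable_const ‖A r.1 * B r.2‖).mono'
      (Continuous.aestronglyMeasurable ?_) (Filter.Eventually.of_forall fun q => (hnorm r q).le)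
    exact continuous_const.mul ((continuous_wave τ _).comp (continuous_point τ))
  have h1 := hasSum_integral_of_summable_integral_norm hint (by
    simp only [hnorm, integral_const, probReal_univ, one_smul]
    exact hABn)
  have h2 : ∀ q : ℝ × ℝ, ∑' r, F r q = U (point τ q.1 q.2) * V (point τ q.1 q.2) := by
    intro q
    have hu := hU (point τ q.1 q.2)
    have hv := hV (point τ q.1 q.2)
    rw [← hu.tsum_eq, ← hv.tsum_eq, tsum_mul_tsum_of_summable_norm]
    · refine tsum_congr fun r => ?_
      simp only [hF]
      rw [wave_add]
      ring
    · simpa [norm_wave] using hA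
    · simpa [norm_wave] using hB
  have h3 : ∀ r, ∫ q, F r q ∂squareMeasure = if r.2 = -r.1 then A r.1 * B r.2 else 0 := by
    intro r
    simp only [hF]
    rw [integral_const_mul, integral_wave hτ, mul_ite, mul_one, mul_zero]
    congr 1
    rw [add_comm, add_eq_zero_iff_eq_neg]
  simp only [h2, h3] at h1
  rw [average_cell hτ]
  -- By orthogonality, each fibre over p has the single surviving index -p.
  refine h1.prod_fiberwise (fun p => ?_)
  refine HasSum.congr_fun (hasSum_ite_eq (-p) (A p * B (-p))) fun q => ?_
  split_ifs with hq
  · rw [hq]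
  · rfl

/-! ### Evaluation of the three averages -/

theorem coef_zero_zero (τ : ℂ) : coef τ 0 0 = 1 := by
  simp [coef, dualPoint_zero]

theorem wave_zero (τ x : ℂ) : wave τ 0 x = 1 := by
  simp [wave, dualPoint_zero]

theorem summable_norm_coef_mul_wave {τ : ℂ} (hτ : 0 < τ.im) (y : ℂ) :
    Summable (fun p => ‖coef τ 0 p * wave τ p y‖) := by
  simpa [norm_wave] using summable_norm_coef hτ 0

theorem average_norm_landau_sq {τ : ℂ} (hτ : 0 < τ.im) (k : ℂ) :
    (⨍ x in cell τ, ‖landau τ k x‖ ^ 2) = 1 := by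
  -- Pairing with the constant 1 extracts the zeroth Fourier coefficient.
  have h := hasSum_average_mul hτ (B := fun p => if p = 0 then 1 else 0) (V := fun _ => 1)
    (summable_norm_coef_mul_wave hτ (Complex.I * k))
    (summable_of_ne_finset_zero (s := {0}) (fun p hp => by
      rw [if_neg (by simpa using hp), norm_zero]))
    (hasSum_norm_landau_sq hτ k) (fun x => by
      have := hasSum_single (f := fun p : ℤ × ℤ => (if p = 0 then 1 else 0) * wave τ p x) 0
        (fun p hp => by rw [if_neg hp, zero_mul])
      rwa [if_pos rfl, one_mul, wave_zero] at this)
  have h' := h.unique (hasSum_single (0 : ℤ × ℤ) (fun p hp => by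
    rw [if_neg (neg_ne_zero.2 hp), mul_zero]))
  simp only [mul_one, neg_zero, if_true, coef_zero_zero, wave_zero] at h'
  rw [average, integral_complex_ofReal] at h'
  exact_mod_cast h'

theorem isNormalizedSolution_landau {τ : ℂ} (hτ : 0 < τ.im) (k : ℂ) :
    IsNormalizedSolution τ k (landau τ k) where
  contDiff := contDiff_landau hτ k
  eigen := eigen_landau hτ k
  quasiPeriodic m n x := landau_add hτ k x m n
  normalized := average_norm_landau_sq hτ k

theorem neg_one_zpow_mul_self (j : ℤ) : (-1 : ℂ) ^ j * (-1 : ℂ) ^ j = 1 := by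
  rw [← mul_zpow]
  norm_num

/-- Both signs equal (-1)^{p₁p₂} and cancel, which is why none appear in the final sums. -/
theorem coef_mul_coef_neg (τ k : ℂ) (p : ℤ × ℤ) :
    coef τ k p * coef τ (-k) (-p)
      = Complex.exp (((-(1 / 2) * ‖dualPoint τ p - k‖ ^ 2 : ℝ) : ℂ)
        + Complex.I * (((conj k * dualPoint τ p).im : ℝ) : ℂ)) := by
  have h1 : ‖-dualPoint τ p - -k‖ = ‖dualPoint τ p - k‖ := by
    rw [neg_sub_neg, norm_sub_rev]
  rw [coef, coef, dualPoint_neg, h1, mul_mul_mul_comm, ← Complex.exp_add, Prod.fst_neg,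
    Prod.snd_neg, neg_mul_neg, neg_one_zpow_mul_self, one_mul, map_neg, neg_mul_neg]
  congr 1
  push_cast
  ring

theorem hasSum_average_norm_sq {τ : ℂ} (hτ : 0 < τ.im) (k : ℂ) :
    HasSum (fun t : dualLattice τ => Real.exp (-(1 / 2) * ‖(t : ℂ)‖ ^ 2)
        * Real.cos (conj k * (t : ℂ)).im)
      (⨍ x in cell τ, ‖landau τ 0 x‖ ^ 2 * ‖landau τ k x‖ ^ 2) := by
  have h := hasSum_average_mul hτ (summable_norm_coef_mul_wave hτ (Complex.I * 0))
    (summable_norm_coef_mul_wave hτ (Complex.I * k))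
    (hasSum_norm_landau_sq hτ 0) (hasSum_norm_landau_sq hτ k)
  simp only [← Complex.ofReal_mul] at h
  rw [average, integral_complex_ofReal] at h
  rw [← (dualEquiv hτ).hasSum_iff]
  -- The mean is real, so real parts replace the phase e^{-i Im(k̄t)} by a cosine.
  refine ((Complex.hasSum_re h).congr_fun fun p => ?_)
  have h1 := coef_mul_coef_neg τ 0 p
  simp only [neg_zero, sub_zero, map_zero, zero_mul, Complex.zero_im, Complex.ofReal_zero,
    mul_zero, add_zero, ← Complex.ofReal_exp] at h1
  have h2 : inner ℝ (dualPoint τ (-p)) (Complex.I * k) = -(conj k * dualPoint τ p).im := by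
    rw [dualPoint_neg, Complex.inner]
    simp
    ring
  simp only [mul_zero, Function.comp, coe_dualEquiv]
  have h3 : wave τ p 0 = 1 := by simp [wave]
  rw [h3, mul_one, ← mul_assoc, h1, wave, h2, Complex.re_ofReal_mul, mul_comm Complex.I,
    Complex.exp_ofReal_mul_I_re, Real.cos_neg]

theorem hasSum_average_mixed {τ : ℂ} (hτ : 0 < τ.im) (k : ℂ) :
    HasSum (fun t : dualLattice τ => Complex.exp (((-(1 / 2) * ‖(t : ℂ) + k‖ ^ 2 : ℝ) : ℂ)
        + Complex.I * (((conj k * (t : ℂ)).im : ℝ) : ℂ)))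
      (conj (⨍ x in cell τ, landau τ 0 x ^ 2 * conj (landau τ k x) * conj (landau τ (-k) x))) := by
  have h := hasSum_average_mul hτ (summable_norm_coef hτ k) (summable_norm_coef hτ (-k))
    (hasSum_landau_zero_mul_conj hτ k) (hasSum_landau_zero_mul_conj hτ (-k))
  have h1 : ∀ x, Complex.exp (Complex.I * ((inner ℝ k x : ℝ) : ℂ)) * landau τ 0 x
      * conj (landau τ k x) * (Complex.exp (Complex.I * ((inner ℝ (-k) x : ℝ) : ℂ)) * landau τ 0 x
      * conj (landau τ (-k) x))
      = landau τ 0 x ^ 2 * conj (landau τ k x) * conj (landau τ (-k) x) := by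
    intro x
    have : Complex.exp (Complex.I * ((inner ℝ k x : ℝ) : ℂ))
        * Complex.exp (Complex.I * ((inner ℝ (-k) x : ℝ) : ℂ)) = 1 := by
      rw [← Complex.exp_add, inner_neg_left, Complex.ofReal_neg, mul_neg, add_neg_cancel,
        Complex.exp_zero]
    linear_combination landau τ 0 x ^ 2 * conj (landau τ k x) * conj (landau τ (-k) x) * this
  simp only [h1, coef_mul_coef_neg] at h
  rw [← (dualEquiv hτ).hasSum_iff, ← (Equiv.neg (ℤ × ℤ)).hasSum_iff]
  -- Conjugation together with t ↦ -t turns |t - k| into |t + k| and preserves the phase; the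
  -- modulus in γ_k does not see the conjugation.
  refine (Complex.hasSum_conj'.2 h).congr_fun fun p => ?_
  have h2 : ‖-dualPoint τ p + k‖ = ‖dualPoint τ p - k‖ := by
    rw [← norm_neg, neg_add_rev, neg_neg, neg_add_eq_sub]
  simp only [Function.comp, coe_dualEquiv, Equiv.neg_apply, dualPoint_neg, h2]
  rw [← Complex.exp_conj, map_add, map_mul, Complex.conj_I, Complex.conj_ofReal,
    Complex.conj_ofReal, mul_neg, Complex.neg_im, Complex.ofReal_neg, mul_neg,
    neg_mul Complex.I]

theorem summable_gaussian {τ : ℂ} (hτ : 0 < τ.im) (k : ℂ) :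
    Summable (fun t : dualLattice τ => Real.exp (-(1 / 2) * ‖(t : ℂ) + k‖ ^ 2)) := by
  rw [← (dualEquiv hτ).summable_iff]
  exact summable_exp_dualPoint hτ k (by norm_num)

/-- Unimodular constants leave the moduli unchanged and multiply the mixed average by a number of
modulus one. -/
theorem gammaK_eq {τ : ℂ} (hτ : 0 < τ.im) {φ : ℂ → ℂ → ℂ}
    (hφ : ∀ k, IsNormalizedSolution τ k (φ k)) (k : ℂ) :
    gammaK τ φ k = gammaK τ (landau τ) k := by
  choose c hc h using fun k => (isNormalizedSolution_landau hτ k).unique hτ (hφ k)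
  have h1 : ∀ x, φ 0 x ^ 2 * conj (φ k x) * conj (φ (-k) x)
      = (c 0 ^ 2 * conj (c k) * conj (c (-k)))
        * (landau τ 0 x ^ 2 * conj (landau τ k x) * conj (landau τ (-k) x)) := by
    intro x
    rw [h 0, h k, h (-k), map_mul, map_mul]
    ring
  simp only [gammaK, h1]
  have h2 : ∀ (b : ℂ) (f : ℂ → ℂ), ⨍ x in cell τ, b * f x = b * ⨍ x in cell τ, f x :=
    fun b f => integral_const_mul _ _
  rw [h2, norm_mul]
  simp only [h, norm_mul, hc, one_mul, norm_pow, RCLike.norm_conj, one_pow]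

end Abrikosov

/-- The normalized solutions `φ_k` exist and are unique up to a constant phase, and for any choice
of them `γ_k(τ)` is given by the (convergent) sums over the dual lattice. -/
theorem theorem1p4 (τ : ℂ) (hτ : 0 < τ.im) :
    (∀ k : ℂ, (∃ φ : ℂ → ℂ, Abrikosov.IsNormalizedSolution τ k φ) ∧
      ∀ φ ψ : ℂ → ℂ, Abrikosov.IsNormalizedSolution τ k φ → Abrikosov.IsNormalizedSolution τ k ψ →
        ∃ c : ℂ, ‖c‖ = 1 ∧ ∀ x, ψ x = c * φ x) ∧
    (∀ k : ℂ,
      Summable (fun t : Abrikosov.dualLattice τ => Real.exp (-(1 / 2) * ‖(t : ℂ)‖ ^ 2)) ∧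
      Summable (fun t : Abrikosov.dualLattice τ =>
        Real.exp (-(1 / 2) * ‖(t : ℂ)‖ ^ 2) * Real.cos (conj k * (t : ℂ)).im) ∧
      Summable (fun t : Abrikosov.dualLattice τ =>
        Complex.exp (((-(1 / 2) * ‖(t : ℂ) + k‖ ^ 2 : ℝ) : ℂ)
          + Complex.I * (((conj k * (t : ℂ)).im : ℝ) : ℂ)))) ∧
    (∀ φ : ℂ → ℂ → ℂ, (∀ k, Abrikosov.IsNormalizedSolution τ k (φ k)) → ∀ k : ℂ,
      Abrikosov.gammaK τ φ k =
        2 * (∑' t : Abrikosov.dualLattice τ,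
          Real.exp (-(1 / 2) * ‖(t : ℂ)‖ ^ 2) * Real.cos (conj k * (t : ℂ)).im)
        + ‖∑' t : Abrikosov.dualLattice τ,
            Complex.exp (((-(1 / 2) * ‖(t : ℂ) + k‖ ^ 2 : ℝ) : ℂ)
              + Complex.I * (((conj k * (t : ℂ)).im : ℝ) : ℂ))‖
        - ∑' t : Abrikosov.dualLattice τ, Real.exp (-(1 / 2) * ‖(t : ℂ)‖ ^ 2)) := by
  refine ⟨fun k => ⟨⟨_, Abrikosov.isNormalizedSolution_landau hτ k⟩, fun φ ψ hφ hψ =>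
    hφ.unique hτ hψ⟩, fun k => ⟨?_, (Abrikosov.hasSum_average_norm_sq hτ k).summable,
    (Abrikosov.hasSum_average_mixed hτ k).summable⟩, fun φ hφ k => ?_⟩
  · simpa using Abrikosov.summable_gaussian hτ 0
  -- At k = 0 the cosines are 1 and the average is that of |φ₀|⁴.
  · have h0 := Abrikosov.hasSum_average_norm_sq hτ 0
    simp only [map_zero, zero_mul, Complex.zero_im, Real.cos_zero, mul_one, ← pow_add] at h0
    rw [Abrikosov.gammaK_eq hτ hφ, (Abrikosov.hasSum_average_norm_sq hτ k).tsum_eq,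
      (Abrikosov.hasSum_average_mixed hτ k).tsum_eq, h0.tsum_eq, RCLike.norm_conj,
      Abrikosov.gammaK]
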